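/- Let $\tau(n)$ be Ramanujan's tau function, defined by $$\Delta(z)=q\prod_{n\ge1}(1-q^n)^{24}=\sum_{n\ge1}\tau(n)q^n,\qquad q=e^{2\pi i z},\ \operatorname{Im} z>0,$$ and let $\sigma_k(n)=\sum_{d\mid n}d^k$, the sum being over the positive divisors of $n$. Then for every integer $n\ge1$: (i) $\displaystyle \tau(n)=n^2\sigma_7(n)-540\sum_{m=1}^{n-1}m(n-m)\,\sigma_3(m)\sigma_3(n-m),$ (ii) $\displaystyle \tau(n)=-\frac54\,n^2\sigma_7(n)+\frac94\,n^2\sigma_3(n)+540\sum_{m=1}^{n-1}m^2\,\sigma_3(m)\sigma_3(n-m),$ (iii) $\displaystyle \tau(n)=n^2\sigma_7(n)-\frac{1080}{n}\sum_{m=1}^{n-1}m^2(n-m)\,\sigma_3(m)\sigma_3(n-m),$ (iv) $\displaystyle \tau(n)=-\frac12\,n^2\sigma_7(n)+\frac32\,n^2\sigma_3(n)+\frac{360}{n}\sum_{m=1}^{n-1}m^3\,\sigma_3(m)\sigma_3(n-m).$ -/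

import Mathlib

open scoped ArithmeticFunction.sigma

/-- Ramanujan's cusp form `Δ(z) = q ∏_{n ≥ 1} (1 - q^n)^24`, with `q = exp(2πiz)` and `z` in the
upper half-plane. -/
noncomputable def ramanujanDelta (z : UpperHalfPlane) : ℂ :=
  Function.Periodic.qParam 1 z *
    ∏' n : ℕ, (1 - Function.Periodic.qParam 1 z ^ (n + 1)) ^ 24

/-- Ramanujan's tau function: `τ(n)` is the coefficient of `q^n` in the `q`-expansion of `Δ`. -/
noncomputable def ramanujanTau (n : ℕ) : ℂ :=
  (UpperHalfPlane.qExpansion 1 ramanujanDelta).coeff n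

/-- The product above is Mathlib's modular discriminant. -/
theorem ramanujanDelta_eq : ramanujanDelta = ModularForm.discriminant := by
  funext z
  exact (ModularForm.discriminant_eq_q_prod z).symm

/-- The defining expansion `Δ(z) = ∑ τ(n) q^n`, with convergence (and `q = exp(2πiz)`). -/
theorem hasSum_ramanujanTau (z : UpperHalfPlane) :
    HasSum (fun n : ℕ => ramanujanTau n * Complex.exp (2 * Real.pi * Complex.I * z) ^ n)
      (ramanujanDelta z) := by
  have h := ModularForm.hasSum_qExpansion (f := CuspForm.discriminant) one_pos (by simp) z
  simpa [ramanujanTau, ramanujanDelta_eq, Function.Periodic.qParam] using h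

/-- There is no constant term, so that the expansion is over `n ≥ 1`. -/
theorem ramanujanTau_zero : ramanujanTau 0 = 0 := by
  have h := CuspFormClass.qExpansion_coeff_zero CuspForm.discriminant one_pos (by simp)
  simpa [ramanujanTau, ramanujanDelta_eq] using h

/-- The normalization `τ(1) = 1`. -/
theorem ramanujanTau_one : ramanujanTau 1 = 1 := by
  simpa [ramanujanTau, ramanujanDelta_eq] using ModularForm.discriminant_qExpansion_coeff_one

/-!
Write `D = q d/dq`. All four identities come from two relations between level one modular forms,
both forced by the scarcity of cusp forms.

* In weight `8` there are no cusp forms, so `E₄² = E₈`. The coefficient of `qⁿ` evaluates the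
  convolution `∑ σ₃(m) σ₃(n - m)` (`sum_sigma_three_mul_sigma_three`).
* The second Rankin–Cohen bracket `4 E₄ D²E₄ - 5 (DE₄)²` is a modular form of weight `12`
  (`rankinCohenTwo_slash`). Its expansion starts with `960 q`, so it equals `960 Δ`
  (`rankinCohenTwo_E₄_qExpansion`). The coefficient of `qⁿ` expresses `τ(n)` through the sums of
  `m² σ₃(m) σ₃(n - m)` and `m (n - m) σ₃(m) σ₃(n - m)` (`ramanujanTau_eq_sum`).

The symmetry `m ↔ n - m` gives linear relations between the convolution sums weighted by `1`,
`m (n - m)`, `m²`, `m² (n - m)` and `m³`, and each identity is a linear combination of these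
relations and the two coefficient identities.

The holomorphy at the cusp that the bracket needs is obtained by differentiating `q`-expansions
termwise (`IsQSeries.hasSum_normalizedDeriv`): a function with a convergent `q`-expansion is bounded
at `i∞`.
-/

section

open UpperHalfPlane ModularForm MatrixGroups Derivative EisensteinSeries
open Filter Function
open scoped Manifold Topology

/-! ### Derivatives of `q`-expansions -/

/-- A function on the upper half-plane is a *power series in `q`* if it is `1`-periodic,
holomorphic and bounded at `i∞`. By Riemann's removable singularity theorem these are exactly the
functions `∑ aₙ qⁿ` with a power series converging on the open unit disc. -/
structure IsQSeries (f : ℍ → ℂ) : Prop where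
  periodic : Periodic (f ∘ ofComplex) (1 : ℝ)
  mdiff : MDiff f
  bdd : IsBoundedAtImInfty f

namespace IsQSeries

variable {f g : ℍ → ℂ}

lemma of_modularForm {k : ℤ} (f : ModularForm 𝒮ℒ k) : IsQSeries f where
  periodic := SlashInvariantFormClass.periodic_comp_ofComplex f one_mem_strictPeriods_SL
  mdiff := ModularFormClass.holo f
  bdd := ModularFormClass.bdd_at_infty f

lemma analyticAt (hf : IsQSeries f) : AnalyticAt ℂ (cuspFunction 1 f) 0 :=
  analyticAt_cuspFunction_zero one_pos hf.periodic hf.mdiff hf.bdd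

lemma mul (hf : IsQSeries f) (hg : IsQSeries g) : IsQSeries (f * g) where
  periodic := hf.periodic.mul hg.periodic
  mdiff := hf.mdiff.mul hg.mdiff
  bdd := hf.bdd.mul hg.bdd

lemma sub (hf : IsQSeries f) (hg : IsQSeries g) : IsQSeries (f - g) where
  periodic := hf.periodic.sub hg.periodic
  mdiff := hf.mdiff.sub hg.mdiff
  bdd := Asymptotics.IsBigO.sub hf.bdd hg.bdd

lemma smul (c : ℂ) (hf : IsQSeries f) : IsQSeries (c • f) where
  periodic := fun z ↦ by simpa using congrArg (c * ·) (hf.periodic z)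
  mdiff := hf.mdiff.const_smul c
  bdd := hf.bdd.const_smul_left c

/-- Termwise differentiation: `D = q d/dq` multiplies the `n`-th coefficient by `n`. -/
lemma hasSum_normalizedDeriv (hf : IsQSeries f) (τ : ℍ) :
    HasSum (fun n : ℕ ↦ ((n : ℂ) * (qExpansion 1 f).coeff n) • Periodic.qParam 1 τ ^ n)
      (D f τ) := by
  set q := Periodic.qParam 1 (τ : ℂ) with hq
  set F := cuspFunction 1 f with hF
  have hq1 : ‖q‖ < 1 := Periodic.norm_qParam_lt_one one_pos τ.im_pos
  have hFd : DifferentiableOn ℂ F (Metric.ball 0 1) :=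
    differentiableOn_cuspFunction_ball one_pos hf.periodic hf.mdiff hf.bdd
  have hqd : HasDerivAt (Periodic.qParam 1) (2 * Real.pi * Complex.I * q) (τ : ℂ) := by
    have h := ((hasDerivAt_id (τ : ℂ)).const_mul (2 * Real.pi * Complex.I)).cexp
    have hfun : Periodic.qParam 1 = fun z ↦ Complex.exp (2 * Real.pi * Complex.I * z) :=
      funext fun z ↦ by simp [Periodic.qParam]
    simpa [q, hfun, mul_comm] using h
  have hcomp : f ∘ ofComplex =ᶠ[𝓝 (τ : ℂ)] F ∘ Periodic.qParam 1 := by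
    filter_upwards [isOpen_upperHalfPlaneSet.mem_nhds τ.im_pos] with w hw
    have := eq_cuspFunction ⟨w, hw⟩ one_ne_zero hf.periodic
    simpa [ofComplex_apply_of_im_pos hw] using this.symm
  have hD : D f τ = q * deriv F q := by
    have hFq : HasDerivAt F (deriv F q) q :=
      (hFd.differentiableAt (Metric.isOpen_ball.mem_nhds (by simpa using hq1))).hasDerivAt
    rw [normalizedDerivOfComplex, hcomp.deriv_eq, (hFq.comp (τ : ℂ) hqd).deriv]
    field_simp [Complex.two_pi_I_ne_zero]
  have hs := (Complex.hasSum_taylorSeries_on_ball (hFd.deriv Metric.isOpen_ball)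
    (z := q) (by simpa using hq1)).mul_left q
  rw [← hD] at hs
  -- The constant term of `D f` vanishes, which shifts the index by one.
  rw [← hasSum_nat_add_iff' 1]
  simp only [Finset.range_one, Finset.sum_singleton, Nat.cast_zero, zero_mul, zero_smul, sub_zero]
  refine hs.congr_fun fun n ↦ ?_
  rw [qExpansion_coeff, ← hF, iteratedDeriv_succ', Nat.factorial_succ]
  have h1 : (n.factorial : ℂ) ≠ 0 := mod_cast n.factorial_ne_zero
  have h2 : (n : ℂ) + 1 ≠ 0 := mod_cast n.succ_ne_zero
  simp only [smul_eq_mul, sub_zero]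
  push_cast
  field_simp
  ring

lemma normalizedDeriv (hf : IsQSeries f) : IsQSeries (D f) where
  periodic := fun z ↦ by
    by_cases hz : 0 < z.im
    · have hz' : 0 < (z + (1 : ℝ)).im := by simpa using hz
      have h : deriv (f ∘ ofComplex) (z + (1 : ℝ)) = deriv (f ∘ ofComplex) z := by
        rw [← deriv_comp_add_const]
        exact congrArg (deriv · z) (funext hf.periodic)
      simp only [comp_apply, normalizedDerivOfComplex, ofComplex_apply_of_im_pos hz,
        ofComplex_apply_of_im_pos hz', h]
    · have hz' : ¬ 0 < (z + (1 : ℝ)).im := by simpa using hz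
      simp only [comp_apply]
      rw [ofComplex_apply_of_im_nonpos (not_lt.mp hz), ofComplex_apply_of_im_nonpos (not_lt.mp hz')]
  mdiff := normalizedDerivOfComplex_mdifferentiable hf.mdiff
  bdd := isBoundedAtImInfty_of_hasSum_qExpansion one_pos hf.hasSum_normalizedDeriv

lemma coeff_normalizedDeriv (hf : IsQSeries f) (n : ℕ) :
    (qExpansion 1 (D f)).coeff n = n * (qExpansion 1 f).coeff n := by
  have hD := hf.normalizedDeriv
  have h1 := hasFPowerSeriesOnBall_cuspFunction one_pos hD.analyticAt
    (hasSum_qExpansion one_pos hD.periodic hD.mdiff hD.bdd)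
  have h2 := hasFPowerSeriesOnBall_cuspFunction one_pos hD.analyticAt hf.hasSum_normalizedDeriv
  simpa using congrArg (FormalMultilinearSeries.coeff · n)
    (h1.hasFPowerSeriesAt.eq_formalMultilinearSeries h2.hasFPowerSeriesAt)

end IsQSeries

/-! ### The second Rankin–Cohen bracket -/

/-- The second Rankin–Cohen bracket of `f` with itself, for `f` of weight `k`, up to a constant
factor: `k f D²f - (k + 1) (Df)²`. -/
noncomputable def rankinCohenTwo (k : ℤ) (f : ℍ → ℂ) : ℍ → ℂ :=
  (k : ℂ) • (f * D (D f)) - ((k : ℂ) + 1) • (D f * D f)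

lemma isQSeries_rankinCohenTwo (k : ℤ) {f : ℍ → ℂ} (hf : IsQSeries f) :
    IsQSeries (rankinCohenTwo k f) :=
  ((hf.mul hf.normalizedDeriv.normalizedDeriv).smul _).sub
    ((hf.normalizedDeriv.mul hf.normalizedDeriv).smul _)

lemma coeff_rankinCohenTwo (k : ℤ) {f : ℍ → ℂ} (hf : IsQSeries f) (n : ℕ) :
    (qExpansion 1 (rankinCohenTwo k f)).coeff n =
      k * ∑ p ∈ Finset.HasAntidiagonal.antidiagonal n, (qExpansion 1 f).coeff p.1 *
          (p.2 ^ 2 * (qExpansion 1 f).coeff p.2) -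
        (k + 1) * ∑ p ∈ Finset.HasAntidiagonal.antidiagonal n, (p.1 * (qExpansion 1 f).coeff p.1) *
          (p.2 * (qExpansion 1 f).coeff p.2) := by
  have hD := hf.normalizedDeriv
  have hDD := hD.normalizedDeriv
  rw [rankinCohenTwo, UpperHalfPlane.qExpansion_sub ((hf.mul hDD).smul _).analyticAt
      ((hD.mul hD).smul _).analyticAt,
    UpperHalfPlane.qExpansion_smul (hf.mul hDD).analyticAt,
    UpperHalfPlane.qExpansion_smul (hD.mul hD).analyticAt,
    UpperHalfPlane.qExpansion_mul hf.analyticAt hDD.analyticAt,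
    UpperHalfPlane.qExpansion_mul hD.analyticAt hD.analyticAt]
  simp only [map_sub, PowerSeries.coeff_smul, PowerSeries.coeff_mul, smul_eq_mul,
    hD.coeff_normalizedDeriv, hf.coeff_normalizedDeriv]
  simp only [← mul_assoc, pow_two]

/-- The factor `c / (2πi (cz + d))` by which `D` fails to commute with the slash action. -/
noncomputable def derivCocycle (γ : SL(2, ℤ)) (z : ℍ) : ℂ :=
  (2 * Real.pi * Complex.I)⁻¹ * (((γ 1 0 : ℤ) : ℂ) / denom γ z)

lemma hasDerivAt_derivCocycle (γ : SL(2, ℤ)) (z : ℍ) :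
    HasDerivAt (derivCocycle γ ∘ ofComplex)
      (-(2 * Real.pi * Complex.I) * derivCocycle γ z ^ 2) z := by
  have h := (((hasDerivAt_denom_zpow (γ : GL (Fin 2) ℝ) (-1) z).const_mul
    ((γ 1 0 : ℤ) : ℂ))).const_mul (2 * Real.pi * Complex.I)⁻¹
  have hz := denom_ne_zero (γ : GL (Fin 2) ℝ) z
  refine (h.congr_of_eventuallyEq ?_).congr_deriv ?_
  · filter_upwards [isOpen_upperHalfPlaneSet.mem_nhds z.im_pos] with w hw
    simp [derivCocycle, ofComplex_apply_of_im_pos hw, div_eq_mul_inv]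
  · simp only [derivCocycle]
    rw [show (-1 - 1 : ℤ) = -2 by norm_num, zpow_neg]
    have := Complex.two_pi_I_ne_zero
    simp
    field_simp
    rw [Complex.I_sq]
    ring

lemma normalizedDeriv_derivCocycle (γ : SL(2, ℤ)) :
    D (derivCocycle γ) = -(derivCocycle γ) ^ 2 := by
  ext z
  rw [normalizedDerivOfComplex, (hasDerivAt_derivCocycle γ z).deriv]
  have := Complex.two_pi_I_ne_zero
  simp only [Pi.neg_apply, Pi.pow_apply]
  field_simp

lemma mdifferentiable_derivCocycle (γ : SL(2, ℤ)) : MDiff (derivCocycle γ) := fun z ↦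
  UpperHalfPlane.mdifferentiableAt_iff.mpr (hasDerivAt_derivCocycle γ z).differentiableAt

lemma normalizedDeriv_slash {k : ℤ} {f : ℍ → ℂ} (hf : MDiff f) (γ : SL(2, ℤ)) :
    D f ∣[k + 2] γ = D (f ∣[k] γ) + (k : ℂ) • (derivCocycle γ * f ∣[k] γ) := by
  rw [normalizedDerivOfComplex_SL_slash hf]
  ext z
  simp [derivCocycle]
  ring

/-- If `f` transforms with weight `k`, its second Rankin–Cohen bracket transforms with weight
`2k + 4`: writing `u` for `derivCocycle γ`, the slash action sends `Df` to `Df + k u f` and `D²f` to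
`D²f + 2 (k + 1) u Df + k (k + 1) u² f`, and the terms in `u` cancel. -/
lemma rankinCohenTwo_slash {k : ℤ} {f : ℍ → ℂ} (hf : MDiff f) {γ : SL(2, ℤ)}
    (h : f ∣[k] γ = f) :
    rankinCohenTwo k f ∣[2 * k + 4] γ = rankinCohenTwo k f := by
  have hu := mdifferentiable_derivCocycle γ
  have hDf := normalizedDerivOfComplex_mdifferentiable hf
  have h1 : D f ∣[k + 2] γ = D f + (k : ℂ) • (derivCocycle γ * f) := by
    rw [normalizedDeriv_slash hf, h]
  have h2 : D (D f) ∣[k + 2 + 2] γ = D (D f)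
      + (k : ℂ) • (-(derivCocycle γ) ^ 2 * f + derivCocycle γ * D f)
      + ((k + 2 : ℤ) : ℂ) • (derivCocycle γ * (D f + (k : ℂ) • (derivCocycle γ * f))) := by
    rw [normalizedDeriv_slash hDf, h1,
      normalizedDerivOfComplex_add _ _ hDf ((hu.mul hf).const_smul _),
      normalizedDerivOfComplex_smul _ _ (hu.mul hf), normalizedDerivOfComplex_mul _ _ hu hf,
      normalizedDeriv_derivCocycle]
  have e1 : (f * D (D f)) ∣[2 * k + 4] γ = f ∣[k] γ * D (D f) ∣[k + 2 + 2] γ := by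
    rw [← mul_slash_SL2]; congr 1; ring
  have e2 : (D f * D f) ∣[2 * k + 4] γ = D f ∣[k + 2] γ * D f ∣[k + 2] γ := by
    rw [← mul_slash_SL2]; congr 1; ring
  rw [rankinCohenTwo, sub_eq_add_neg, SlashAction.add_slash, SlashAction.neg_slash,
    SL_smul_slash, SL_smul_slash, e1, e2, h1, h2, h]
  ext z
  simp
  ring

/-- The second Rankin–Cohen bracket of a level one modular form with itself, as a modular form. -/
noncomputable def rankinCohenTwoForm {k : ℤ} (f : ModularForm 𝒮ℒ k) :
    ModularForm 𝒮ℒ (2 * k + 4) where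
  toFun := rankinCohenTwo k f
  slash_action_eq' := fun _ ⟨γ, hγ⟩ ↦ hγ ▸ rankinCohenTwo_slash (ModularFormClass.holo f)
    (f.slash_action_eq' _ ⟨γ, rfl⟩)
  holo' := (isQSeries_rankinCohenTwo k (.of_modularForm f)).mdiff
  bdd_at_cusps' {c} hc := by
    rw [Subgroup.IsArithmetic.isCusp_iff_isCusp_SL2Z] at hc
    rw [OnePoint.isBoundedAt_iff_forall_SL2Z hc]
    intro γ _
    rw [rankinCohenTwo_slash (ModularFormClass.holo f) (f.slash_action_eq' _ ⟨γ, rfl⟩)]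
    exact (isQSeries_rankinCohenTwo k (.of_modularForm f)).bdd

/-! ### The two identities between modular forms -/

lemma E₄_qExpansion_coeff (n : ℕ) :
    (qExpansion 1 E₄).coeff n = if n = 0 then 1 else 240 * (σ 3 n : ℂ) := by
  rw [E_qExpansion_coeff _ ⟨2, rfl⟩]
  norm_num [show bernoulli 4 = -1 / 30 by decide +kernel]

/-- The Eisenstein series of weight `8` is `E₄²`, because there are no cusp forms of weight `8`. -/
lemma E₄_sq_qExpansion_coeff (n : ℕ) :
    (qExpansion 1 E₄ * qExpansion 1 E₄).coeff n = if n = 0 then 1 else 480 * (σ 7 n : ℂ) := by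
  set E₈ : ModularForm 𝒮ℒ 8 := E (by norm_num : 3 ≤ 8) with hE₈
  set f : ModularForm 𝒮ℒ 8 := ModularForm.mcast (by norm_num) (E₄.mul E₄)
  have hq : qExpansion 1 f = qExpansion 1 E₄ * qExpansion 1 E₄ :=
    ModularForm.qExpansion_mul one_pos one_mem_strictPeriods_SL E₄ E₄
  have h0 : f - E₈ = 0 := by
    apply sturm_bound_levelOne
    refine lt_of_lt_of_le (b := ((1 : ℕ) : ℕ∞)) (by norm_num) (PowerSeries.nat_le_order _ _ ?_)
    intro i hi
    obtain rfl : i = 0 := by lia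
    rw [FunLike.coe_sub, ModularForm.qExpansion_sub one_pos one_mem_strictPeriods_SL, map_sub, hE₈,
      E_qExpansion_coeff_zero _ ⟨4, rfl⟩, hq, PowerSeries.coeff_mul]
    simp [E₄_qExpansion_coeff, -PowerSeries.coeff_zero_eq_constantCoeff]
  rw [← hq, sub_eq_zero.mp h0, hE₈, E_qExpansion_coeff _ ⟨4, rfl⟩]
  norm_num [show bernoulli 8 = -1 / 30 by decide +kernel]

/-- The form `4 E₄ D²E₄ - 5 (DE₄)²` has weight `12` and starts with `960 q`, so it is `960 Δ`. -/
lemma rankinCohenTwo_E₄_qExpansion :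
    qExpansion 1 (rankinCohenTwo 4 E₄) = (960 : ℂ) • qExpansion 1 discriminant := by
  have hc (n : ℕ) := coeff_rankinCohenTwo 4 (.of_modularForm E₄) n
  set f : ModularForm 𝒮ℒ 12 := ModularForm.mcast (by norm_num) (rankinCohenTwoForm E₄)
  set Δ : ModularForm 𝒮ℒ 12 := CuspForm.toModularFormₗ CuspForm.discriminant
  have hf : (f : ℍ → ℂ) = rankinCohenTwo 4 E₄ := rfl
  have hΔ : (Δ : ℍ → ℂ) = discriminant := rfl
  have hΔ0 : (qExpansion 1 discriminant).coeff 0 = 0 :=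
    CuspFormClass.qExpansion_coeff_zero CuspForm.discriminant one_pos one_mem_strictPeriods_SL
  have hsmul : qExpansion 1 (((960 : ℂ) • Δ : ModularForm 𝒮ℒ 12) : ℍ → ℂ) =
      (960 : ℂ) • qExpansion 1 discriminant := by
    rw [FunLike.coe_smul, ModularForm.qExpansion_smul one_pos one_mem_strictPeriods_SL, hΔ]
  have h0 : f - (960 : ℂ) • Δ = 0 := by
    apply sturm_bound_levelOne
    refine lt_of_lt_of_le (b := ((2 : ℕ) : ℕ∞)) (by decide) (PowerSeries.nat_le_order _ _ ?_)
    intro i hi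
    rw [FunLike.coe_sub, ModularForm.qExpansion_sub one_pos one_mem_strictPeriods_SL, hsmul, hf,
      map_sub, PowerSeries.coeff_smul, hc]
    interval_cases i
    · rw [hΔ0]
      simp
    · rw [discriminant_qExpansion_coeff_one]
      norm_num [E₄_qExpansion_coeff, Finset.Nat.antidiagonal_succ]
  rw [← hsmul, ← sub_eq_zero.mp h0, hf]

/-! ### Comparison of coefficients -/

lemma sum_antidiagonal_eq_sum_Icc {M : Type*} [AddCommMonoid M] (g : ℕ → ℕ → M) {n : ℕ}
    (hn : 1 ≤ n) : ∑ p ∈ Finset.HasAntidiagonal.antidiagonal n, g p.1 p.2 =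
      g 0 n + g n 0 + ∑ m ∈ Finset.Icc 1 (n - 1), g m (n - m) := by
  obtain ⟨n, rfl⟩ : ∃ k, n = k + 1 := ⟨n - 1, by lia⟩
  rw [Finset.Nat.sum_antidiagonal_eq_sum_range_succ, Finset.sum_range_succ, Finset.sum_range_succ',
    Nat.add_sub_cancel, Finset.range_eq_Ico,
    Finset.sum_Ico_add' (fun m ↦ g m (n + 1 - m)) 0 n 1, zero_add, Nat.sub_self, Nat.sub_zero,
    show Finset.Ico 1 (n + 1) = Finset.Icc 1 n by ext; simp]
  abel

lemma sum_Icc_reflect {M : Type*} [AddCommMonoid M] (g : ℕ → ℕ → M) (n : ℕ) :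
    ∑ m ∈ Finset.Icc 1 (n - 1), g m (n - m) = ∑ m ∈ Finset.Icc 1 (n - 1), g (n - m) m := by
  refine Finset.sum_nbij' (n - ·) (n - ·) ?_ ?_ ?_ ?_ ?_
  all_goals
    intro m hm
    rw [Finset.mem_Icc] at hm
  · rw [Finset.mem_Icc]; lia
  · rw [Finset.mem_Icc]; lia
  · lia
  · lia
  · rw [Nat.sub_sub_self (by lia)]

/-- Comparison of coefficients in `E₄² = E₈`. -/
lemma sum_sigma_three_mul_sigma_three {n : ℕ} (hn : 1 ≤ n) :
    120 * ∑ m ∈ Finset.Icc 1 (n - 1), (σ 3 m : ℂ) * (σ 3 (n - m) : ℂ) =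
      (σ 7 n : ℂ) - (σ 3 n : ℂ) := by
  have h := E₄_sq_qExpansion_coeff n
  have hn0 : n ≠ 0 := by lia
  rw [PowerSeries.coeff_mul, sum_antidiagonal_eq_sum_Icc
    (fun i j ↦ (qExpansion 1 E₄).coeff i * (qExpansion 1 E₄).coeff j) hn] at h
  have hs : ∑ m ∈ Finset.Icc 1 (n - 1), (qExpansion 1 E₄).coeff m * (qExpansion 1 E₄).coeff (n - m)
      = 57600 * ∑ m ∈ Finset.Icc 1 (n - 1), (σ 3 m : ℂ) * (σ 3 (n - m) : ℂ) := by
    rw [Finset.mul_sum]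
    refine Finset.sum_congr rfl fun m hm ↦ ?_
    rw [Finset.mem_Icc] at hm
    rw [E₄_qExpansion_coeff, E₄_qExpansion_coeff, if_neg (by lia), if_neg (by lia)]
    ring
  rw [hs, E₄_qExpansion_coeff, E₄_qExpansion_coeff, if_pos rfl, if_neg hn0, if_neg hn0] at h
  linear_combination h / 480

/-- Comparison of coefficients in `4 E₄ D²E₄ - 5 (DE₄)² = 960 Δ`. -/
lemma ramanujanTau_eq_sum {n : ℕ} (hn : 1 ≤ n) :
    ramanujanTau n = (n : ℂ) ^ 2 * (σ 3 n : ℂ)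
      + 240 * ∑ m ∈ Finset.Icc 1 (n - 1), (m : ℂ) ^ 2 * (σ 3 m : ℂ) * (σ 3 (n - m) : ℂ)
      - 300 * ∑ m ∈ Finset.Icc 1 (n - 1),
          (m : ℂ) * ((n : ℂ) - (m : ℂ)) * (σ 3 m : ℂ) * (σ 3 (n - m) : ℂ) := by
  have hn0 : n ≠ 0 := by lia
  have h := coeff_rankinCohenTwo 4 (.of_modularForm E₄) n
  rw [rankinCohenTwo_E₄_qExpansion, PowerSeries.coeff_smul, ← ramanujanDelta_eq, ← ramanujanTau,
    sum_antidiagonal_eq_sum_Icc (fun i j ↦ (qExpansion 1 E₄).coeff i *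
      ((j : ℂ) ^ 2 * (qExpansion 1 E₄).coeff j)) hn,
    sum_antidiagonal_eq_sum_Icc (fun i j ↦ ((i : ℂ) * (qExpansion 1 E₄).coeff i) *
      ((j : ℂ) * (qExpansion 1 E₄).coeff j)) hn,
    sum_Icc_reflect (fun i j ↦ (qExpansion 1 E₄).coeff i *
      ((j : ℂ) ^ 2 * (qExpansion 1 E₄).coeff j))] at h
  have hs1 : ∑ m ∈ Finset.Icc 1 (n - 1), (qExpansion 1 E₄).coeff (n - m) *
      ((m : ℂ) ^ 2 * (qExpansion 1 E₄).coeff m) = 57600 * ∑ m ∈ Finset.Icc 1 (n - 1),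
        (m : ℂ) ^ 2 * (σ 3 m : ℂ) * (σ 3 (n - m) : ℂ) := by
    rw [Finset.mul_sum]
    refine Finset.sum_congr rfl fun m hm ↦ ?_
    rw [Finset.mem_Icc] at hm
    rw [E₄_qExpansion_coeff, E₄_qExpansion_coeff, if_neg (by lia), if_neg (by lia)]
    ring
  have hs2 : ∑ m ∈ Finset.Icc 1 (n - 1), ((m : ℂ) * (qExpansion 1 E₄).coeff m) *
      (((n - m : ℕ) : ℂ) * (qExpansion 1 E₄).coeff (n - m)) = 57600 * ∑ m ∈ Finset.Icc 1 (n - 1),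
        (m : ℂ) * ((n : ℂ) - (m : ℂ)) * (σ 3 m : ℂ) * (σ 3 (n - m) : ℂ) := by
    rw [Finset.mul_sum]
    refine Finset.sum_congr rfl fun m hm ↦ ?_
    rw [Finset.mem_Icc] at hm
    rw [E₄_qExpansion_coeff, E₄_qExpansion_coeff, if_neg (by lia), if_neg (by lia),
      Nat.cast_sub (by lia)]
    ring
  rw [hs1, hs2, E₄_qExpansion_coeff, E₄_qExpansion_coeff, if_pos rfl, if_neg hn0] at h
  simp only [smul_eq_mul] at h
  push_cast at h
  linear_combination h / 960

end

/-- The four van der Pol-type identities for Ramanujan's tau function, for every `n ≥ 1`. Here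
`σ k m` is the sum of the `k`-th powers of the positive divisors of `m`. -/
theorem theorem2p1 (n : ℕ) (hn : 1 ≤ n) :
    ramanujanTau n =
        (n : ℂ) ^ 2 * (σ 7 n : ℂ)
          - 540 * ∑ m ∈ Finset.Icc 1 (n - 1),
              (m : ℂ) * ((n : ℂ) - (m : ℂ)) * (σ 3 m : ℂ) * (σ 3 (n - m) : ℂ) ∧
    ramanujanTau n =
        -(5 / 4 : ℂ) * (n : ℂ) ^ 2 * (σ 7 n : ℂ) + (9 / 4 : ℂ) * (n : ℂ) ^ 2 * (σ 3 n : ℂ)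
          + 540 * ∑ m ∈ Finset.Icc 1 (n - 1),
              (m : ℂ) ^ 2 * (σ 3 m : ℂ) * (σ 3 (n - m) : ℂ) ∧
    ramanujanTau n =
        (n : ℂ) ^ 2 * (σ 7 n : ℂ)
          - (1080 / (n : ℂ)) * ∑ m ∈ Finset.Icc 1 (n - 1),
              (m : ℂ) ^ 2 * ((n : ℂ) - (m : ℂ)) * (σ 3 m : ℂ) * (σ 3 (n - m) : ℂ) ∧
    ramanujanTau n =
        -(1 / 2 : ℂ) * (n : ℂ) ^ 2 * (σ 7 n : ℂ) + (3 / 2 : ℂ) * (n : ℂ) ^ 2 * (σ 3 n : ℂ)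
          + (360 / (n : ℂ)) * ∑ m ∈ Finset.Icc 1 (n - 1),
              (m : ℂ) ^ 3 * (σ 3 m : ℂ) * (σ 3 (n - m) : ℂ) := by
  have hn0 : (n : ℂ) ≠ 0 := mod_cast (by lia : n ≠ 0)
  -- The symmetry `m ↔ n - m` reduces all the sums to that of `m (n - m) σ₃(m) σ₃(n - m)` and to the
  -- unweighted one, which `E₄² = E₈` evaluates.
  have hsymm (p : ℂ → ℂ) : ∑ m ∈ Finset.Icc 1 (n - 1), p m * (σ 3 m : ℂ) * (σ 3 (n - m) : ℂ) =
      ∑ m ∈ Finset.Icc 1 (n - 1), p (n - m) * (σ 3 m : ℂ) * (σ 3 (n - m) : ℂ) := by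
    rw [sum_Icc_reflect (fun i j ↦ p i * (σ 3 i : ℂ) * (σ 3 j : ℂ))]
    refine Finset.sum_congr rfl fun m hm ↦ ?_
    rw [Finset.mem_Icc] at hm
    rw [Nat.cast_sub (by lia)]
    ring
  have hA := sum_sigma_three_mul_sigma_three hn
  have hτ := ramanujanTau_eq_sum hn
  have h2 := hsymm (fun x ↦ x ^ 2)
  have h3 := hsymm (fun x ↦ x ^ 3)
  have h21 := hsymm (fun x ↦ x ^ 2 * (n - x))
  set A := ∑ m ∈ Finset.Icc 1 (n - 1), (σ 3 m : ℂ) * (σ 3 (n - m) : ℂ) with hAdef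
  set B := ∑ m ∈ Finset.Icc 1 (n - 1),
    (m : ℂ) * ((n : ℂ) - (m : ℂ)) * (σ 3 m : ℂ) * (σ 3 (n - m) : ℂ) with hBdef
  set C₂ := ∑ m ∈ Finset.Icc 1 (n - 1), (m : ℂ) ^ 2 * (σ 3 m : ℂ) * (σ 3 (n - m) : ℂ) with hC₂
  set C₃ := ∑ m ∈ Finset.Icc 1 (n - 1), (m : ℂ) ^ 3 * (σ 3 m : ℂ) * (σ 3 (n - m) : ℂ) with hC₃
  set F := ∑ m ∈ Finset.Icc 1 (n - 1),
    (m : ℂ) ^ 2 * ((n : ℂ) - (m : ℂ)) * (σ 3 m : ℂ) * (σ 3 (n - m) : ℂ) with hF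
  -- `n² = m² + (n - m)² + 2 m (n - m)`
  have e2 : (n : ℂ) ^ 2 * A = 2 * C₂ + 2 * B := by
    rw [two_mul C₂]
    nth_rw 2 [h2]
    rw [hAdef, hBdef, hC₂, Finset.mul_sum, Finset.mul_sum, ← Finset.sum_add_distrib,
      ← Finset.sum_add_distrib]
    exact Finset.sum_congr rfl fun m _ ↦ by ring
  -- `n³ = m³ + (n - m)³ + 3 n m (n - m)`
  have e3 : (n : ℂ) ^ 3 * A = 2 * C₃ + 3 * n * B := by
    rw [two_mul C₃]
    nth_rw 2 [h3]
    rw [hAdef, hBdef, hC₃, Finset.mul_sum, Finset.mul_sum, ← Finset.sum_add_distrib,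
      ← Finset.sum_add_distrib]
    exact Finset.sum_congr rfl fun m _ ↦ by ring
  -- `n m (n - m) = m² (n - m) + (n - m)² m`
  have e21 : (n : ℂ) * B = 2 * F := by
    rw [two_mul F]
    nth_rw 2 [h21]
    rw [hBdef, hF, Finset.mul_sum, ← Finset.sum_add_distrib]
    exact Finset.sum_congr rfl fun m _ ↦ by ring
  have t1 : ramanujanTau n = (n : ℂ) ^ 2 * (σ 7 n : ℂ) - 540 * B := by
    linear_combination hτ - 120 * e2 + (n : ℂ) ^ 2 * hA
  refine ⟨t1, ?_, ?_, ?_⟩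
  · linear_combination t1 + 270 * e2 - 9 / 4 * (n : ℂ) ^ 2 * hA
  · field_simp
    linear_combination n * t1 - 540 * e21
  · field_simp
    linear_combination 2 * n * t1 + 360 * e3 - 3 * (n : ℂ) ^ 3 * hA
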